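/- Let $K$ be a number field with ring of integers $\mathcal{O}_K$, with $s$ real embeddings and $t$ pairs of complex conjugate embeddings. Let $\Sigma$ consist of the real embeddings and one embedding from each complex pair, and let $\iota : K \to \mathbb{R}^s \times \mathbb{C}^t$, $\iota(\alpha) = (\rho(\alpha))_{\rho \in \Sigma}$. Let $D_K \subset \mathbb{R}^s \times \mathbb{C}^t$ be a fundamental domain of the lattice $\iota(\mathcal{O}_K)$, and let $\lambda$ be Lebesgue measure. Let $I_K$ be the set of nonzero ideals of $\mathcal{O}_K$. For $\gamma \in K$ let $\operatorname{dn}(\gamma) \in I_K$ be the unique nonzero ideal $\mathfrak{n}$ such that $(\gamma) = \mathfrak{a}/\mathfrak{n}$ with $\mathfrak{a}$ an ideal of $\mathcal{O}_K$ coprime to $\mathfrak{n}$. For each $\rho \in \Sigma$ let $\psi_\rho : I_K \to \mathbb{R}_{\ge 0}$ be a function, and put $$\Psi(\mathfrak{n}) = \prod_{\rho \text{ real}} \psi_\rho(\mathfrak{n}) \cdot \prod_{\rho \text{ complex}} \psi_\rho(\mathfrak{n})^2 .$$ Call $\gamma \in K$ a $\Psi$-good approximation to $\mathbf{x} \in \mathbb{R}^s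 \times \mathbb{C}^t$ if $|x_\rho - \rho(\gamma)|_\rho \le \psi_\rho(\operatorname{dn}(\gamma))$ for every $\rho \in \Sigma$, where $|\cdot|_\rho$ is the usual absolute value for real $\rho$ and the square of the usual absolute value for complex $\rho$. Let $\mathcal{A}'$ be the set of $\mathbf{x} \in D_K$ that have infinitely many $\Psi$-good approximations $\gamma \in K$. If $\Psi(\mathfrak{n}) \to 0$ as $N(\mathfrak{n}) \to \infty$, then $\lambda(\mathcal{A}') = 0$ or $\lambda(\mathcal{A}') = \lambda(D_K)$. Under the same hypothesis, the same conclusion holds when $|\cdot|_\rho$ is taken to be the usual absolute value for complex $\rho$ as well. -/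

import Mathlib

open NumberField NumberField.InfinitePlace
open scoped NNReal nonZeroDivisors Classical

noncomputable section

namespace ZeroOneLaw

variable {K : Type*} [Field K]

/-- The denominator ideal of `γ ∈ K`, namely `{d ∈ 𝓞 K : d γ ∈ 𝓞 K}`. By `dnm_spec` and `dnm_unique`
it is the unique nonzero ideal `𝔫` such that `(γ) = 𝔞 / 𝔫` with `𝔞` an integral ideal coprime to `𝔫`. -/
def dnm (γ : K) : Ideal (𝓞 K) where
  carrier := {d | ∃ b : 𝓞 K, (d : K) * γ = b}
  add_mem' := by
    rintro x y ⟨b, hb⟩ ⟨c, hc⟩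
    exact ⟨b + c, by push_cast; rw [add_mul, hb, hc]⟩
  zero_mem' := ⟨0, by simp⟩
  smul_mem' := by
    rintro r x ⟨b, hb⟩
    exact ⟨r * b, by simp only [smul_eq_mul]; push_cast; rw [mul_assoc, hb]⟩

theorem dnm_unique [NumberField K] {γ : K} {a n : Ideal (𝓞 K)} (hn : n ≠ ⊥) (hc : IsCoprime a n)
    (h : FractionalIdeal.spanSingleton (𝓞 K)⁰ γ =
      (a : FractionalIdeal (𝓞 K)⁰ K) / (n : FractionalIdeal (𝓞 K)⁰ K)) :
    n = dnm γ := by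
  have hn' : (n : FractionalIdeal (𝓞 K)⁰ K) ≠ 0 := FractionalIdeal.coeIdeal_ne_zero.mpr hn
  rw [eq_div_iff hn'] at h
  ext d
  have h1 : d ∈ n ↔ n ∣ Ideal.span {d} * a := by
    rw [← Ideal.span_singleton_le_iff_mem, ← Ideal.dvd_iff_le]
    exact ⟨fun H => H.mul_right _, fun H => hc.symm.dvd_of_dvd_mul_right H⟩
  have h2 : d ∈ dnm γ ↔ FractionalIdeal.spanSingleton (𝓞 K)⁰ ((d : K) * γ) ≤ 1 := by
    rw [FractionalIdeal.spanSingleton_le_iff_mem, FractionalIdeal.mem_one_iff]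
    exact ⟨fun ⟨b, hb⟩ => ⟨b, hb.symm⟩, fun ⟨b, hb⟩ => ⟨b, hb.symm⟩⟩
  rw [h1, h2, Ideal.dvd_iff_le, ← FractionalIdeal.coeIdeal_le_coeIdeal K,
    FractionalIdeal.coeIdeal_mul, FractionalIdeal.coeIdeal_span_singleton, ← h, ← mul_assoc,
    FractionalIdeal.spanSingleton_mul_spanSingleton]
  constructor
  · intro H
    have H2 := mul_le_mul_left H (n : FractionalIdeal (𝓞 K)⁰ K)⁻¹
    rwa [mul_assoc, mul_inv_cancel₀ hn', mul_one] at H2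
  · intro H
    simpa using mul_le_mul_left H (n : FractionalIdeal (𝓞 K)⁰ K)

theorem dnm_spec [NumberField K] (γ : K) :
    dnm γ ≠ ⊥ ∧ ∃ a : Ideal (𝓞 K), IsCoprime a (dnm γ) ∧
      FractionalIdeal.spanSingleton (𝓞 K)⁰ γ =
        (a : FractionalIdeal (𝓞 K)⁰ K) / (dnm γ : FractionalIdeal (𝓞 K)⁰ K) := by
  obtain ⟨b, c, hc, rfl⟩ := IsFractionRing.div_surjective (A := 𝓞 K) γ
  have hc0 : c ≠ 0 := nonZeroDivisors.ne_zero hc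
  obtain ⟨a, ha⟩ := Ideal.dvd_iff_le.mpr (le_sup_left : Ideal.span {b} ≤ Ideal.span {b} ⊔ Ideal.span {c})
  obtain ⟨n, hn⟩ := Ideal.dvd_iff_le.mpr (le_sup_right : Ideal.span {c} ≤ Ideal.span {b} ⊔ Ideal.span {c})
  set g := Ideal.span {b} ⊔ Ideal.span {c} with hg
  have hcs : Ideal.span {c} ≠ ⊥ := by simpa [Ideal.span_singleton_eq_bot] using hc0
  have hg0 : g ≠ ⊥ := by rintro h; rw [h] at hn; exact hcs (by simpa using hn)
  have hn0 : n ≠ ⊥ := by rintro h; rw [h] at hn; exact hcs (by simpa using hn)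
  have hcop : IsCoprime a n := by
    rw [Ideal.isCoprime_iff_sup_eq]
    have : g * (a ⊔ n) = g * ⊤ := by
      rw [Ideal.mul_sup, ← ha, ← hn, Ideal.mul_top]
    exact mul_left_cancel₀ hg0 this
  have hc' : algebraMap (𝓞 K) K c ≠ 0 := by simpa using hc0
  have key : FractionalIdeal.spanSingleton (𝓞 K)⁰ (algebraMap (𝓞 K) K b / algebraMap (𝓞 K) K c) =
      (a : FractionalIdeal (𝓞 K)⁰ K) / (n : FractionalIdeal (𝓞 K)⁰ K) := by
    have hn' : (n : FractionalIdeal (𝓞 K)⁰ K) ≠ 0 := FractionalIdeal.coeIdeal_ne_zero.mpr hn0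
    have hg' : (g : FractionalIdeal (𝓞 K)⁰ K) ≠ 0 := FractionalIdeal.coeIdeal_ne_zero.mpr hg0
    rw [eq_div_iff hn']
    apply mul_left_cancel₀ hg'
    rw [← FractionalIdeal.coeIdeal_mul, ← ha, mul_left_comm, ← FractionalIdeal.coeIdeal_mul, ← hn,
      FractionalIdeal.coeIdeal_span_singleton, FractionalIdeal.coeIdeal_span_singleton,
      FractionalIdeal.spanSingleton_mul_spanSingleton, div_mul_cancel₀ _ hc']
  have hd := dnm_unique hn0 hcop key
  rw [← hd]
  exact ⟨hn0, a, hcop, key⟩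

/-- The product `Ψ(𝔫)` of `ψ_w(𝔫)` over the real places and of `ψ_w(𝔫)²` over the complex places. -/
def bigPsi [NumberField K] (ψ : InfinitePlace K → Ideal (𝓞 K) → ℝ≥0) (n : Ideal (𝓞 K)) : ℝ≥0 :=
  (∏ w : {w : InfinitePlace K // IsReal w}, ψ w n) *
    ∏ w : {w : InfinitePlace K // IsComplex w}, ψ w n ^ 2

/-- `γ` is a `ψ`-good approximation to `x ∈ ℝ^s × ℂ^t`, where a complex coordinate is measured
by the square of the usual complex absolute value. -/
def IsGoodApprox (ψ : InfinitePlace K → Ideal (𝓞 K) → ℝ≥0) (x : mixedEmbedding.mixedSpace K)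
    (γ : K) : Prop :=
  (∀ w : {w : InfinitePlace K // IsReal w}, |x.1 w - (mixedEmbedding K γ).1 w| ≤ ψ w (dnm γ)) ∧
    ∀ w : {w : InfinitePlace K // IsComplex w},
      ‖x.2 w - (mixedEmbedding K γ).2 w‖ ^ 2 ≤ ψ w (dnm γ)

/-- The variant in which a complex coordinate is measured by the usual complex absolute value. -/
def IsGoodApproxUsual (ψ : InfinitePlace K → Ideal (𝓞 K) → ℝ≥0) (x : mixedEmbedding.mixedSpace K)
    (γ : K) : Prop :=
  (∀ w : {w : InfinitePlace K // IsReal w}, |x.1 w - (mixedEmbedding K γ).1 w| ≤ ψ w (dnm γ)) ∧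
    ∀ w : {w : InfinitePlace K // IsComplex w},
      ‖x.2 w - (mixedEmbedding K γ).2 w‖ ≤ ψ w (dnm γ)

/-- The points of `D` with infinitely many good approximations, for a given notion of `good`. -/
def approxSet (D : Set (mixedEmbedding.mixedSpace K))
    (good : mixedEmbedding.mixedSpace K → K → Prop) : Set (mixedEmbedding.mixedSpace K) :=
  {x ∈ D | {γ : K | good x γ}.Infinite}

end ZeroOneLaw

end

/-!
The set `A` of all points of `ℝ^s × ℂ^t` with infinitely many good approximations is periodic under
the lattice of integers, and it suffices to show that `A` is null or conull. Both notions of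
approximation bound the usual absolute value at each infinite place `w` by a radius depending on
`w` and on the denominator of `γ`. As `Ψ → 0`, the smallest of the radii goes to zero, although the
others may stay away from zero or be unbounded. Sorting the denominators by the place of the
smallest radius, one may assume that the radii at a fixed place `w₀` go to zero
(`approxPts_univ_const`).

*Change of scale.* On each line (or complex line) in the direction of `w₀`, Cassels' lemma shows
that multiplying the radii at `w₀` by a constant changes `A` by a null set only
(`approxPts_update_ae_le`). The same holds for all radii at once (`approxPts_const_mul_ae_le`): by
Dirichlet there is a unit `u` that is as small as desired at all places other than `w₀`;
multiplication by `u` preserves denominators and preserves measure modulo the lattice, and it turns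
a constant factor in all radii into one at `w₀`.

*Gallagher's argument.* Some power of a prime ideal `P` is principal, say `P ^ h = (π)`. Every `γ ∈
K` is a sum `γ' + τ`, where `γ'` has a denominator coprime to `π` and `τ ∈ 𝓞 K[1/π]`. For fixed `τ`
the denominator of `γ' + τ` does not change when `γ'` is multiplied by a unit or by `π`. So the set
of points approximated by such `γ'` is, up to a change of scale, invariant under multiplication by
`π`, which is ergodic modulo the lattice since `𝓞 K[1/π]` is dense (`dense_iUnion_inv_pow`); it is
null or conull (`approxPts_coprimeDen_const`). If it is conull for some `τ`, then so is its
translate by `τ`, and `A` contains this. If it is null for all `τ`, then for each `k` the finitely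
many `τ ∈ π⁻ᵏ 𝓞 K` modulo `𝓞 K` may be discarded, and the denominators of the remaining `γ` do not
change under translation by `π⁻ᵏ 𝓞 K` (`dnm_add_of_mem_highLevel`). Hence `A` is almost everywhere
invariant under the dense group `𝓞 K[1/π]` of translations, and so null or conull
(`approxPts_dnm_const`).
-/

noncomputable section

namespace ZeroOneLaw

open MeasureTheory Filter Topology NumberField.mixedEmbedding
open scoped Pointwise

/-! ### Translations and endomorphisms of a torus -/

section Torus

variable {E : Type*} [NormedAddCommGroup E] [NormedSpace ℝ E] [FiniteDimensional ℝ E]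
  [MeasurableSpace E] [BorelSpace E] (L : Submodule ℤ E) [DiscreteTopology L] [IsZLattice ℝ L]
  (μ : Measure E) [μ.IsAddHaarMeasure]

omit [μ.IsAddHaarMeasure] in
theorem exists_bounded_fundamentalDomain :
    ∃ F : Set E, Bornology.IsBounded F ∧ IsAddFundamentalDomain L F μ ∧
      ∀ x, ∃ ℓ ∈ L, x - ℓ ∈ F := by
  let b := (Module.Free.chooseBasis ℤ L)
  refine ⟨ZSpan.fundamentalDomain (b.ofZLatticeBasis ℝ), ZSpan.fundamentalDomain_isBounded _,
    ZLattice.isAddFundamentalDomain b μ, fun x => ?_⟩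
  have h := ZSpan.fract_mem_fundamentalDomain (b.ofZLatticeBasis ℝ) x
  refine ⟨ZSpan.floor (b.ofZLatticeBasis ℝ) x, ?_, h⟩
  exact (b.ofZLatticeBasis_span ℝ).le (ZSpan.floor (b.ofZLatticeBasis ℝ) x).2

omit [MeasurableSpace E] [BorelSpace E] in
theorem compactSpace_quotient_lattice : CompactSpace (E ⧸ L.toAddSubgroup) := by
  borelize E
  obtain ⟨F, hFb, -, hF⟩ := exists_bounded_fundamentalDomain L (Measure.addHaar : Measure E)
  have : ProperSpace E := FiniteDimensional.proper_real E
  have hc : IsCompact (closure F) := hFb.isCompact_closure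
  refine ⟨?_⟩
  convert hc.image (QuotientAddGroup.continuous_mk (N := L.toAddSubgroup))
  refine (Set.eq_univ_of_forall fun y => ?_).symm
  obtain ⟨x, rfl⟩ := QuotientAddGroup.mk_surjective y
  obtain ⟨ℓ, hℓ, hx⟩ := hF x
  refine ⟨x - ℓ, subset_closure hx, ?_⟩
  rw [QuotientAddGroup.eq]
  simpa using hℓ

omit [NormedSpace ℝ E] [FiniteDimensional ℝ E] [MeasurableSpace E] [BorelSpace E]
  [IsZLattice ℝ L] in
theorem isClosed_lattice : IsClosed (L.toAddSubgroup : Set E) := by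
  have : DiscreteTopology L.toAddSubgroup := ‹DiscreteTopology L›
  exact AddSubgroup.isClosed_of_discrete

/-- A finite Haar measure on `E ⧸ L` whose null sets are those with null preimage in `E`: the
pushforward of the restriction of `μ` to a bounded fundamental domain. -/
theorem exists_haar_torus : ∃ ν : Measure (E ⧸ L.toAddSubgroup), ν.IsAddHaarMeasure ∧
    IsFiniteMeasure ν ∧ ∀ t : Set (E ⧸ L.toAddSubgroup), MeasurableSet t →
      (ν t = 0 ↔ μ ((QuotientAddGroup.mk : E → E ⧸ L.toAddSubgroup) ⁻¹' t) = 0) := by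
  have : ProperSpace E := FiniteDimensional.proper_real E
  obtain ⟨F, hFb, hFd, -⟩ := exists_bounded_fundamentalDomain L μ
  have hmk : Measurable (QuotientAddGroup.mk : E → E ⧸ L.toAddSubgroup) :=
    QuotientAddGroup.continuous_mk.measurable
  have : IsClosed (L.toAddSubgroup : Set E) := isClosed_lattice L
  have hvi : VAddInvariantMeasure L E μ := ⟨fun c s _ => measure_preimage_add μ (c : E) s⟩
  set ν : Measure (E ⧸ L.toAddSubgroup) := Measure.map QuotientAddGroup.mk (μ.restrict F) with hν
  have hper : ∀ t : Set (E ⧸ L.toAddSubgroup), ∀ g : L,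
      (fun x => g +ᵥ x) ⁻¹' ((QuotientAddGroup.mk : E → E ⧸ L.toAddSubgroup) ⁻¹' t) =
        (QuotientAddGroup.mk : E → E ⧸ L.toAddSubgroup) ⁻¹' t := by
    intro t g
    ext x
    have : (QuotientAddGroup.mk (g +ᵥ x) : E ⧸ L.toAddSubgroup) = QuotientAddGroup.mk x := by
      rw [QuotientAddGroup.eq, Submodule.vadd_def, vadd_eq_add]
      simp
    simp only [Set.mem_preimage, this]
  have happ : ∀ t : Set (E ⧸ L.toAddSubgroup), MeasurableSet t →
      ν t = μ ((QuotientAddGroup.mk : E → E ⧸ L.toAddSubgroup) ⁻¹' t ∩ F) := fun t ht => by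
    rw [hν, Measure.map_apply hmk ht, Measure.restrict_apply (hmk ht)]
  have hnull : ∀ t : Set (E ⧸ L.toAddSubgroup), MeasurableSet t →
      (ν t = 0 ↔ μ ((QuotientAddGroup.mk : E → E ⧸ L.toAddSubgroup) ⁻¹' t) = 0) := by
    intro t ht
    rw [happ t ht]
    refine ⟨fun h => hFd.measure_zero_of_invariant _ (fun g => ?_) h,
      fun h => measure_mono_null Set.inter_subset_left h⟩
    rw [← Set.preimage_vadd_neg]
    exact hper t (-g)
  have hfin : IsFiniteMeasure ν := ⟨by
    rw [happ _ MeasurableSet.univ]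
    exact (measure_mono Set.inter_subset_right).trans_lt hFb.measure_lt_top⟩
  have hinv : ν.IsAddLeftInvariant := by
    refine ⟨fun y => ?_⟩
    obtain ⟨v, rfl⟩ := QuotientAddGroup.mk_surjective y
    ext t ht
    rw [Measure.map_apply (measurable_const_add _) ht, happ _ (measurable_const_add _ ht),
      happ _ ht]
    have hFd' : IsAddFundamentalDomain L (v +ᵥ F) μ := hFd.vadd_of_comm v
    rw [hFd.measure_set_eq hFd' (hmk ht) (hper t), ← measure_preimage_add μ v (_ ∩ (v +ᵥ F))]
    congr 1
    ext x
    simp [Set.mem_vadd_set_iff_neg_vadd_mem]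
  refine ⟨ν, ?_, hfin, hnull⟩
  have hop : ν.IsOpenPosMeasure := by
    refine ⟨fun U hU hne h => ?_⟩
    rw [hnull U hU.measurableSet] at h
    obtain ⟨y, hy⟩ := hne
    obtain ⟨x, rfl⟩ := QuotientAddGroup.mk_surjective y
    exact (hU.preimage QuotientAddGroup.continuous_mk).measure_ne_zero μ ⟨x, hy⟩ h
  exact { toIsAddLeftInvariant := hinv, toIsOpenPosMeasure := hop }

omit [NormedSpace ℝ E] [FiniteDimensional ℝ E] [BorelSpace E] [DiscreteTopology L]
  [IsZLattice ℝ L] [μ.IsAddHaarMeasure] in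
variable {μ} in
theorem ae_eq_preimage_mk_iff {ν : Measure (E ⧸ L.toAddSubgroup)}
    (hnull : ∀ t : Set (E ⧸ L.toAddSubgroup), MeasurableSet t →
      (ν t = 0 ↔ μ ((QuotientAddGroup.mk : E → E ⧸ L.toAddSubgroup) ⁻¹' t) = 0))
    {t₁ t₂ : Set (E ⧸ L.toAddSubgroup)} (h₁ : MeasurableSet t₁) (h₂ : MeasurableSet t₂) :
    t₁ =ᵐ[ν] t₂ ↔ (QuotientAddGroup.mk : E → E ⧸ L.toAddSubgroup) ⁻¹' t₁ =ᵐ[μ]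
      (QuotientAddGroup.mk : E → E ⧸ L.toAddSubgroup) ⁻¹' t₂ := by
  rw [ae_eq_set, ae_eq_set, hnull _ (h₁.diff h₂), hnull _ (h₂.diff h₁)]
  rfl

variable {L} in
omit [NormedSpace ℝ E] [FiniteDimensional ℝ E] [BorelSpace E] [DiscreteTopology L]
  [IsZLattice ℝ L] in
theorem exists_measurableSet_quotient {s : Set E} (hs : MeasurableSet s)
    (hper : ∀ ℓ ∈ L, ∀ x ∈ s, x + ℓ ∈ s) : ∃ t : Set (E ⧸ L.toAddSubgroup),
      MeasurableSet t ∧ QuotientAddGroup.mk ⁻¹' t = s := by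
  have h : (QuotientAddGroup.mk : E → E ⧸ L.toAddSubgroup) ⁻¹' (QuotientAddGroup.mk '' s) = s := by
    refine Set.Subset.antisymm ?_ (Set.subset_preimage_image _ _)
    rintro x ⟨y, hy, hxy⟩
    rw [QuotientAddGroup.eq] at hxy
    simpa using hper _ hxy y hy
  exact ⟨_, measurableSet_quotient.mpr (by convert hs), h⟩

variable {μ}

/-- A measurable set that is periodic under a lattice, and almost everywhere invariant under a
dense set of translations, is null or conull. -/
theorem ae_const_of_dense_translations {s : Set E} (hs : MeasurableSet s)
    (hper : ∀ ℓ ∈ L, ∀ x ∈ s, x + ℓ ∈ s) (hd : Dense {v : E | (v + ·) ⁻¹' s =ᵐ[μ] s}) :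
    EventuallyConst s (ae μ) := by
  have : IsClosed (L.toAddSubgroup : Set E) := isClosed_lattice L
  have := compactSpace_quotient_lattice L
  obtain ⟨ν, hν, -, hnull⟩ := exists_haar_torus L μ
  obtain ⟨t, ht, rfl⟩ := exists_measurableSet_quotient hs hper
  suffices h : EventuallyConst t (ae ν) by
    rw [eventuallyConst_set'] at h ⊢
    exact h.imp (ae_eq_preimage_mk_iff L hnull ht .empty).1
      (ae_eq_preimage_mk_iff L hnull ht .univ).1
  refine aeconst_of_dense_setOfPred_preimage_vadd_ae (M := E ⧸ L.toAddSubgroup)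
    ht.nullMeasurableSet ?_
  refine (QuotientAddGroup.mk_surjective.denseRange.dense_image
    (QuotientAddGroup.continuous_mk (N := L.toAddSubgroup)) hd).mono ?_
  rintro _ ⟨v, hv, rfl⟩
  exact (ae_eq_preimage_mk_iff L hnull (ht.preimage (measurable_const_vadd _)) ht).2 hv

theorem quasiMeasurePreserving_of_surjective (f : E →L[ℝ] E) (hf : Function.Surjective f) :
    Measure.QuasiMeasurePreserving f μ μ := by
  have : ProperSpace E := FiniteDimensional.proper_real E
  refine ⟨f.continuous.measurable, ?_⟩
  obtain ⟨c, -, hc⟩ := f.toLinearMap.exists_map_addHaar_eq_smul_addHaar μ μ hf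
  exact (congrArg (· ≪ μ) hc).mpr Measure.smul_absolutelyContinuous

/-- Endomorphisms of a torus preserve Haar measure, so a periodic set that grows under taking
preimages by such an endomorphism is almost everywhere invariant. -/
theorem ae_eq_preimage_of_ae_le {s : Set E} (hs : MeasurableSet s)
    (hper : ∀ ℓ ∈ L, ∀ x ∈ s, x + ℓ ∈ s) (f : E →L[ℝ] E) (hf : Function.Surjective f)
    (hfL : ∀ ℓ ∈ L, f ℓ ∈ L) (h : s ≤ᵐ[μ] f ⁻¹' s) : s =ᵐ[μ] f ⁻¹' s := by
  have : IsClosed (L.toAddSubgroup : Set E) := isClosed_lattice L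
  have := compactSpace_quotient_lattice L
  obtain ⟨ν, hν, -, hnull⟩ := exists_haar_torus L μ
  obtain ⟨t, ht, rfl⟩ := exists_measurableSet_quotient hs hper
  let g : E ⧸ L.toAddSubgroup →+ E ⧸ L.toAddSubgroup :=
    QuotientAddGroup.map _ _ (f : E →+ E) hfL
  have hgc : Continuous g :=
    continuous_quot_lift _ (QuotientAddGroup.continuous_mk.comp f.continuous)
  have hg : MeasurePreserving g ν ν := g.measurePreserving hgc (by
    intro y
    obtain ⟨x, rfl⟩ := QuotientAddGroup.mk_surjective y
    obtain ⟨z, rfl⟩ := hf x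
    exact ⟨z, rfl⟩) rfl
  have h1 : t ≤ᵐ[ν] g ⁻¹' t := by
    rw [ae_le_set, hnull _ (ht.diff (hgc.measurable ht))]
    exact ae_le_set.1 h
  exact (ae_eq_preimage_mk_iff L hnull ht (hgc.measurable ht)).1 <|
    ae_eq_of_ae_subset_of_measure_ge h1 (hg.measure_preimage ht.nullMeasurableSet).le
      ht.nullMeasurableSet (measure_ne_top _ _)

/-- Ergodicity of the endomorphism of a torus induced by `f`, if the points of the torus killed by
some iterate of the endomorphism are dense. -/
theorem ae_const_of_ae_le_preimage {s : Set E} (hs : MeasurableSet s)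
    (hper : ∀ ℓ ∈ L, ∀ x ∈ s, x + ℓ ∈ s) (f : E →L[ℝ] E) (hf : Function.Surjective f)
    (hfL : ∀ ℓ ∈ L, f ℓ ∈ L) (hd : Dense {v : E | ∃ n : ℕ, f^[n] v ∈ L})
    (h : s ≤ᵐ[μ] f ⁻¹' s) : EventuallyConst s (ae μ) := by
  have hqmp := quasiMeasurePreserving_of_surjective (μ := μ) f hf
  have h1 := ae_eq_preimage_of_ae_le L hs hper f hf hfL h
  -- `s` agrees almost everywhere with `f^[n] ⁻¹' s`, which is periodic under `f^[n] ⁻¹' L`.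
  have h2 : ∀ n : ℕ, f^[n] ⁻¹' s =ᵐ[μ] s := by
    intro n
    induction n with
    | zero => rfl
    | succ n ih =>
      rw [Function.iterate_succ, Set.preimage_comp]
      exact (hqmp.preimage_ae_eq ih).trans h1.symm
  refine ae_const_of_dense_translations L hs hper (hd.mono ?_)
  rintro v ⟨n, hn⟩
  have h3 : (v + ·) ⁻¹' (f^[n] ⁻¹' s) = f^[n] ⁻¹' s := by
    ext x
    have : f^[n] (v + x) = f^[n] x + f^[n] v := by
      rw [iterate_map_add, add_comm]
    simp only [Set.mem_preimage, this]
    refine ⟨fun hx => ?_, hper _ hn _⟩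
    simpa using hper _ (L.neg_mem hn) _ hx
  have h4 := (measurePreserving_add_left μ v).quasiMeasurePreserving.preimage_ae_eq (h2 n)
  rw [h3] at h4
  exact h4.symm.trans (h2 n)

end Torus

/-! ### Approximable points and Cassels' lemma in one coordinate -/

section Cassels

/-- Cassels' lemma for a countable family of balls, of which only finitely many with radius at least
`ε` meet a bounded set: multiplying the radii by `M` changes the set of points lying in infinitely
many balls by a null set. -/
theorem ae_infinite_closedBall_of_infinite_mul {I F : Type*} [Countable I] [Infinite I]
    [NormedAddCommGroup F] [SecondCountableTopology F] [MeasurableSpace F] [BorelSpace F]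
    (μ : Measure F) [IsLocallyFiniteMeasure μ] [IsUnifLocDoublingMeasure μ]
    {p : I → Prop} {a : I → F} {ρ : I → ℝ} (hρ : ∀ i, 0 ≤ ρ i) {B : ℝ} (hB : ∀ i, p i → ρ i ≤ B)
    (hfin : ∀ ε > 0, ∀ R : ℝ, {i | p i ∧ ε ≤ ρ i ∧ ‖a i‖ ≤ R}.Finite) {M : ℝ} (hM : 0 < M) :
    ∀ᵐ t ∂μ, {i | p i ∧ ‖t - a i‖ ≤ M * ρ i}.Infinite → {i | p i ∧ ‖t - a i‖ ≤ ρ i}.Infinite := by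
  obtain ⟨_⟩ := nonempty_denumerable_iff.2 ⟨‹Countable I›, ‹Infinite I›⟩
  let e := (Denumerable.eqv I).symm
  have key : ∀ R : ℕ, ∀ᵐ t ∂μ, ‖t‖ ≤ R → {i | p i ∧ ‖t - a i‖ ≤ M * ρ i}.Infinite →
      {i | p i ∧ ‖t - a i‖ ≤ ρ i}.Infinite := by
    intro R
    -- A ball with radius at most `M * B` that meets `‖t‖ ≤ R` has its centre in this larger ball.
    let q : ℕ → Prop := fun n => p (e n) ∧ ‖a (e n)‖ ≤ R + M * B
    let r : ℕ → ℝ := fun n => if q n then ρ (e n) else 0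
    have hr0 : ∀ n, 0 ≤ r n := fun n => by
      simp only [r]; split_ifs
      exacts [hρ _, le_rfl]
    have hr : Tendsto r atTop (𝓝 0) := by
      rw [Metric.tendsto_nhds]
      intro ε hε
      rw [← Nat.cofinite_eq_atTop, eventually_cofinite]
      refine ((hfin ε hε (R + M * B)).preimage e.injective.injOn).subset fun n hn => ?_
      simp only [Set.mem_ofPred, dist_zero_right, Real.norm_of_nonneg (hr0 n), not_lt] at hn
      have hq : q n := by
        by_contra hq
        simp only [r, if_neg hq] at hn
        linarith
      simp only [r, if_pos hq] at hn
      exact ⟨hq.1, hn, hq.2⟩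
    have h := blimsup_cthickening_mul_ae_eq μ q (fun n => {a (e n)}) hM r hr
    rw [← Nat.cofinite_eq_atTop] at h
    simp only [cofinite.blimsup_set_eq, Metric.cthickening_singleton _ (mul_nonneg hM.le (hr0 _)),
      Metric.cthickening_singleton _ (hr0 _), mem_closedBall_iff_norm] at h
    filter_upwards [h.le] with t ht htR hinf
    have h1 : {n | q n ∧ ‖t - a (e n)‖ ≤ M * r n}.Infinite := by
      refine (hinf.preimage (f := e) (by simp)).mono fun n hn => ?_
      have hq : q n := by
        refine ⟨hn.1, ?_⟩
        have h1 := hn.2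
        have h2 := norm_sub_norm_le (a (e n)) t
        rw [norm_sub_rev] at h2
        have h3 := mul_le_mul_of_nonneg_left (hB _ hn.1) hM.le
        linarith
      refine ⟨hq, ?_⟩
      simp only [r, if_pos hq]
      exact hn.2
    refine ((ht h1).image e.injective.injOn).mono ?_
    rintro _ ⟨n, ⟨hq, hn⟩, rfl⟩
    simp only [r, if_pos hq] at hn
    exact ⟨hq.1, hn⟩
  filter_upwards [ae_all_iff.2 key] with t ht
  obtain ⟨R, hR⟩ := exists_nat_ge ‖t‖
  exact ht R hR

theorem ae_le_of_subset {α : Type*} [MeasurableSpace α] {μ : Measure α} {s t : Set α}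
    (h : s ⊆ t) : s ≤ᵐ[μ] t := Eventually.of_forall h

variable {K : Type*} [Field K]

/-- The points of `ℝ^s × ℂ^t` approximated by infinitely many `γ ∈ S`, with error at most `r w γ`
at every infinite place `w`. -/
def approxPts (S : Set K) (r : InfinitePlace K → K → ℝ) : Set (mixedSpace K) :=
  {x | {γ | γ ∈ S ∧ ∀ w, normAtPlace w (x - mixedEmbedding K γ) ≤ r w γ}.Infinite}

theorem approxPts_mono {S S' : Set K} {r r' : InfinitePlace K → K → ℝ} (hS : S ⊆ S')
    (hr : ∀ w, ∀ γ ∈ S, r w γ ≤ r' w γ) : approxPts S r ⊆ approxPts S' r' :=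
  fun _ hx => hx.mono fun γ hγ => ⟨hS hγ.1, fun w => (hγ.2 w).trans (hr w γ hγ.1)⟩

variable [NumberField K]

instance countable_of_numberField : Countable K :=
  (Module.finBasis ℚ K).equivFun.toEquiv.countable_iff.2 inferInstance

theorem measurableSet_approxPts (S : Set K) (r : InfinitePlace K → K → ℝ) :
    MeasurableSet (approxPts S r) := by
  have h : approxPts S r = ⋂ F : Finset K, ⋃ γ : K, {x | γ ∉ F ∧ γ ∈ S ∧
      ∀ w, normAtPlace w (x - mixedEmbedding K γ) ≤ r w γ} := by
    ext x
    simp only [Set.mem_iInter, Set.mem_iUnion, approxPts]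
    refine ⟨fun hx F => ?_, fun hx hfin => ?_⟩
    · obtain ⟨γ, hγ, hF⟩ := hx.exists_notMem_finset F
      exact ⟨γ, hF, hγ⟩
    · obtain ⟨γ, hγ, h⟩ := hx hfin.toFinset
      exact hγ (hfin.mem_toFinset.2 h)
  rw [h]
  refine .iInter fun F => .iUnion fun γ => ?_
  have h' : {x : mixedSpace K | γ ∉ F ∧ γ ∈ S ∧
      ∀ w, normAtPlace w (x - mixedEmbedding K γ) ≤ r w γ} = {_x | γ ∉ F} ∩ ({_x | γ ∈ S} ∩
        ⋂ w, {x | normAtPlace w (x - mixedEmbedding K γ) ≤ r w γ}) := by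
    ext x
    simp
  rw [h']
  refine (MeasurableSet.const _).inter ((MeasurableSet.const _).inter (.iInter fun w => ?_))
  refine (isClosed_le ?_ continuous_const).measurableSet
  have := continuous_normAtPlace (K := K) w
  fun_prop

/-- The radii at the place `w₀` go to zero along the approximations: those with radius at least `ε`
have a common denominator, and all their radii are bounded. -/
def RadiusVanishes (S : Set K) (r : InfinitePlace K → K → ℝ) (w₀ : InfinitePlace K) : Prop :=
  ∀ ε > 0, ∃ R : ℝ, ∃ d : 𝓞 K, d ≠ 0 ∧ ∀ γ ∈ S, ε ≤ r w₀ γ →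
    d ∈ dnm γ ∧ ∀ w, r w γ ≤ R

theorem finite_bounded_of_mem_dnm {d : 𝓞 K} (hd : d ≠ 0) (R : ℝ) :
    {γ : K | d ∈ dnm γ ∧ ∀ w : InfinitePlace K, w γ ≤ R}.Finite := by
  have hd' : (d : K) ≠ 0 := by simpa using hd
  refine Set.Finite.subset ((Embeddings.finite_of_norm_le K ℂ
    ((∑ w : InfinitePlace K, w (d : K)) * R)).preimage
      (mul_right_injective₀ hd').injOn) fun γ hγ => ?_
  obtain ⟨⟨b, hb⟩, hR⟩ := hγ
  refine ⟨?_, fun φ => ?_⟩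
  · change IsIntegral ℤ ((d : K) * γ)
    rw [hb]
    exact b.2
  rw [map_mul, norm_mul]
  refine mul_le_mul ?_ (hR (InfinitePlace.mk φ)) (norm_nonneg _)
    (Finset.sum_nonneg fun w _ => apply_nonneg w _)
  exact Finset.single_le_sum (f := fun w : InfinitePlace K => w (d : K))
    (fun w _ => apply_nonneg w _) (Finset.mem_univ (InfinitePlace.mk φ))

/-- `approxPts_update_ae_le` in terms of a parametrization `ℓ` of the coordinate axis at `w₀` and
the projection `pr` to it. On a translate of the axis the conditions at the places other than `w₀`
do not depend on the point, and the condition at `w₀` describes a ball in the axis, so that Cassels'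
lemma applies; Fubini does the rest. -/
theorem approxPts_update_ae_le_of_line {S : Set K} {r : InfinitePlace K → K → ℝ}
    {w₀ : InfinitePlace K} (hr : ∀ w γ, 0 ≤ r w γ) (hv : RadiusVanishes S r w₀)
    {M : ℝ} (hM : 0 < M) {F : Type*} [NormedAddCommGroup F] [NormedSpace ℝ F]
    [FiniteDimensional ℝ F] [MeasurableSpace F] [BorelSpace F] (μ : Measure F) [μ.IsAddHaarMeasure]
    (ℓ : F →ₗ[ℝ] mixedSpace K) (pr : mixedSpace K →+ F)
    (hℓ₀ : ∀ y t, normAtPlace w₀ (y + ℓ t) = ‖pr y + t‖)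
    (hℓ : ∀ w ≠ w₀, ∀ y t, normAtPlace w (y + ℓ t) = normAtPlace w y) :
    approxPts S (fun w γ => if w = w₀ then M * r w γ else r w γ) ≤ᵐ[volume] approxPts S r := by
  have : ProperSpace F := FiniteDimensional.proper_real F
  refine ae_mem_of_ae_add_linearMap_mem ℓ μ volume
    (s := {x | x ∈ approxPts S (fun w γ => if w = w₀ then M * r w γ else r w γ) →
      x ∈ approxPts S r}) ?_ fun y => ?_
  · exact (measurableSet_approxPts _ _).himp (measurableSet_approxPts _ _)
  obtain ⟨B, d₁, -, hB⟩ := hv 1 one_pos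
  have hcoord : ∀ (γ : K) (t : F), normAtPlace w₀ (y + ℓ t - mixedEmbedding K γ) =
      ‖t - (pr (mixedEmbedding K γ) - pr y)‖ := fun γ t => by
    rw [add_sub_right_comm, hℓ₀, map_sub]
    congr 1
    abel
  have h := ae_infinite_closedBall_of_infinite_mul μ (I := K)
    (p := fun γ => γ ∈ S ∧ ∀ w ≠ w₀, normAtPlace w (y - mixedEmbedding K γ) ≤ r w γ)
    (a := fun γ => pr (mixedEmbedding K γ) - pr y) (ρ := r w₀) (hr w₀) (B := max 1 B)
    (fun γ hγ => ?_) (fun ε hε R => ?_) hM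
  · filter_upwards [h] with t ht hinf
    refine (ht (hinf.mono fun γ hγ => ⟨⟨hγ.1, fun w hw => ?_⟩, ?_⟩)).mono
      fun γ hγ => ⟨hγ.1.1, fun w => ?_⟩
    · have := hγ.2 w
      simpa only [add_sub_right_comm, hℓ w hw, if_neg hw] using this
    · have := hγ.2 w₀
      simpa only [hcoord, if_true] using this
    · by_cases hw : w = w₀
      · subst hw
        rw [hcoord]
        exact hγ.2
      · rw [add_sub_right_comm, hℓ w hw]
        exact hγ.1.2 w hw
  · rcases le_total 1 (r w₀ γ) with h1 | h1
    · exact ((hB γ hγ.1 h1).2 w₀).trans (le_max_right _ _)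
    · exact h1.trans (le_max_left _ _)
  · obtain ⟨R', d, hd, hR'⟩ := hv ε hε
    refine (finite_bounded_of_mem_dnm hd
      (max R R' + ∑ w, normAtPlace w y)).subset fun γ hγ => ?_
    obtain ⟨⟨hγS, hγ⟩, hε, hγR⟩ := hγ
    obtain ⟨hdγ, hbd⟩ := hR' γ hγS hε
    refine ⟨hdγ, fun w => ?_⟩
    have h1 : normAtPlace w y ≤ ∑ w, normAtPlace w y :=
      Finset.single_le_sum (fun w _ => normAtPlace_nonneg w y) (Finset.mem_univ w)
    have h2 : w γ ≤ normAtPlace w (y - mixedEmbedding K γ) + normAtPlace w y := by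
      rw [← normAtPlace_apply, ← normAtPlace_neg w (y - mixedEmbedding K γ)]
      convert normAtPlace_add_le w (-(y - mixedEmbedding K γ)) y using 2
      abel
    have h3 : normAtPlace w (y - mixedEmbedding K γ) ≤ max R R' := by
      by_cases hw : w = w₀
      · subst hw
        refine le_max_of_le_left ?_
        have := hcoord γ 0
        rw [map_zero, add_zero] at this
        rw [this, zero_sub, norm_neg]
        exact hγR
      · exact le_max_of_le_right ((hγ w hw).trans (hbd w))
    linarith

/-- Multiplying the radii at the single place `w₀`, where they go to zero, by a constant does not
enlarge the set of approximable points by more than a null set. -/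
theorem approxPts_update_ae_le {S : Set K} {r : InfinitePlace K → K → ℝ} {w₀ : InfinitePlace K}
    (hr : ∀ w γ, 0 ≤ r w γ) (hv : RadiusVanishes S r w₀) {M : ℝ} (hM : 0 < M) :
    approxPts S (fun w γ => if w = w₀ then M * r w γ else r w γ) ≤ᵐ[volume] approxPts S r := by
  rcases isReal_or_isComplex w₀ with h₀ | h₀
  · refine approxPts_update_ae_le_of_line hr hv hM (F := ℝ) volume
      (LinearMap.inl ℝ _ _ ∘ₗ LinearMap.single ℝ (fun _ => ℝ) ⟨w₀, h₀⟩)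
      ((Pi.evalAddMonoidHom (fun _ => ℝ) ⟨w₀, h₀⟩).comp (AddMonoidHom.fst _ _))
      (fun y t => ?_) fun w hw y t => ?_
    · simp [normAtPlace_apply_of_isReal h₀]
    · rcases isReal_or_isComplex w with h | h
      · simp [normAtPlace_apply_of_isReal h, hw]
      · simp [normAtPlace_apply_of_isComplex h]
  · refine approxPts_update_ae_le_of_line hr hv hM (F := ℂ) volume
      (LinearMap.inr ℝ _ _ ∘ₗ LinearMap.single ℝ (fun _ => ℂ) ⟨w₀, h₀⟩)
      ((Pi.evalAddMonoidHom (fun _ => ℂ) ⟨w₀, h₀⟩).comp (AddMonoidHom.snd _ _))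
      (fun y t => ?_) fun w hw y t => ?_
    · simp [normAtPlace_apply_of_isComplex h₀]
    · rcases isReal_or_isComplex w with h | h
      · simp [normAtPlace_apply_of_isReal h]
      · simp [normAtPlace_apply_of_isComplex h, hw]

end Cassels

/-! ### Multiplication by units and by nonunits -/

section Multiplication

variable {K : Type*} [Field K] [NumberField K]

omit [NumberField K] in
theorem mem_integerLattice {x : mixedSpace K} :
    x ∈ mixedEmbedding.integerLattice K ↔ ∃ a : 𝓞 K, mixedEmbedding K a = x := by
  rfl

omit [NumberField K] in
theorem mul_mem_approxPts {S S' : Set K} {r r' : InfinitePlace K → K → ℝ} {v : K} (hv : v ≠ 0)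
    (h : ∀ γ ∈ S, v * γ ∈ S' ∧ ∀ w : InfinitePlace K, w v * r w γ ≤ r' w (v * γ))
    {x : mixedSpace K} (hx : x ∈ approxPts S r) : mixedEmbedding K v * x ∈ approxPts S' r' := by
  refine (hx.image (mul_right_injective₀ hv).injOn).mono ?_
  rintro _ ⟨γ, ⟨hγ, hγr⟩, rfl⟩
  refine ⟨(h γ hγ).1, fun w => le_trans ?_ ((h γ hγ).2 w)⟩
  rw [map_mul, ← mul_sub, map_mul, normAtPlace_apply]
  exact mul_le_mul_of_nonneg_left (hγr w) (apply_nonneg w v)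

omit [NumberField K] in
theorem add_mem_approxPts {S S' : Set K} {r r' : InfinitePlace K → K → ℝ} (a : K)
    (h : ∀ γ ∈ S, γ + a ∈ S' ∧ ∀ w : InfinitePlace K, r w γ ≤ r' w (γ + a))
    {x : mixedSpace K} (hx : x ∈ approxPts S r) : x + mixedEmbedding K a ∈ approxPts S' r' := by
  refine (hx.image (add_left_injective a).injOn).mono ?_
  rintro _ ⟨γ, ⟨hγ, hγr⟩, rfl⟩
  refine ⟨(h γ hγ).1, fun w => le_trans ?_ ((h γ hγ).2 w)⟩
  rw [map_add, add_sub_add_right_eq_sub]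
  exact hγr w

/-- Multiplication by `v ∈ K` on `ℝ^s × ℂ^t`. -/
def mulMixed (v : K) : mixedSpace K →L[ℝ] mixedSpace K :=
  (LinearMap.mulLeft ℝ (mixedEmbedding K v)).toContinuousLinearMap

theorem mulMixed_apply (v : K) (x : mixedSpace K) : mulMixed v x = mixedEmbedding K v * x := rfl

theorem mulMixed_surjective {v : K} (hv : v ≠ 0) : Function.Surjective (mulMixed v) := fun x =>
  ⟨mixedEmbedding K v⁻¹ * x, by
    rw [mulMixed_apply, ← mul_assoc, ← map_mul, mul_inv_cancel₀ hv, map_one, one_mul]⟩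

theorem mulMixed_iterate (v : K) (n : ℕ) (x : mixedSpace K) :
    (mulMixed v)^[n] x = mixedEmbedding K (v ^ n) * x := by
  induction n generalizing x with
  | zero => simp
  | succ n ih =>
    rw [Function.iterate_succ_apply, ih, mulMixed_apply, ← mul_assoc, ← map_mul, pow_succ]

theorem mulMixed_mem (v : 𝓞 K) : ∀ ℓ ∈ mixedEmbedding.integerLattice K,
    mulMixed (v : K) ℓ ∈ mixedEmbedding.integerLattice K := by
  rintro _ ⟨a, rfl⟩
  exact mem_integerLattice.2 ⟨v * a, by
    change mixedEmbedding K ((v * a : 𝓞 K) : K) = mixedEmbedding K v * mixedEmbedding K a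
    rw [← map_mul, ← map_mul]⟩

/-- The pair `(S, r)` is stable under translation by `a`. -/
def TranslateStable (S : Set K) (r : InfinitePlace K → K → ℝ) (a : K) : Prop :=
  ∀ γ ∈ S, γ + a ∈ S ∧ ∀ w, r w (γ + a) = r w γ

/-- The pair `(S, r)` is stable under multiplication by `v`. -/
def MulStable (S : Set K) (r : InfinitePlace K → K → ℝ) (v : K) : Prop :=
  ∀ γ ∈ S, v * γ ∈ S ∧ ∀ w, r w (v * γ) = r w γ

omit [NumberField K] in
theorem approxPts_periodic {S : Set K} {r : InfinitePlace K → K → ℝ}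
    (h : ∀ a : 𝓞 K, TranslateStable S r a) : ∀ ℓ ∈ mixedEmbedding.integerLattice K,
      ∀ x ∈ approxPts S r, x + ℓ ∈ approxPts S r := by
  rintro _ ⟨a, rfl⟩ x hx
  exact add_mem_approxPts (a : K)
    (fun γ hγ => ⟨(h a γ hγ).1, fun w => ((h a γ hγ).2 w).ge⟩) hx

theorem exists_unit_forall_mul_le_one (w₀ : InfinitePlace K) (M : ℝ) :
    ∃ u : (𝓞 K)ˣ, ∀ w, w ≠ w₀ → w (u : K) * M ≤ 1 := by
  obtain ⟨u, hu⟩ := Units.dirichletUnitTheorem.exists_unit K w₀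
  have h1 : ∀ w : InfinitePlace K, w ≠ w₀ → w (u : K) < 1 := fun w hw => by
    by_contra! h
    exact (hu w hw).not_ge (Real.log_nonneg h)
  have h2 : ∀ w : InfinitePlace K, ∀ᶠ k : ℕ in atTop, w ≠ w₀ → w (u : K) ^ k * M ≤ 1 := by
    intro w
    by_cases hw : w = w₀
    · simp [hw]
    · have h3 := (tendsto_pow_atTop_nhds_zero_of_lt_one (apply_nonneg w (u : K))
        (h1 w hw)).mul_const M
      rw [zero_mul] at h3
      filter_upwards [h3.eventually_le_const one_pos] with k hk _ using hk
  obtain ⟨k, hk⟩ := (eventually_all.2 h2).exists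
  exact ⟨u ^ k, fun w hw => by simpa using hk w hw⟩

/-- Multiplying all radii by a constant does not enlarge the set of approximable points by more than
a null set, although the radii need go to zero at the place `w₀` only: multiplication by a unit that
is small at all other places absorbs the constant there. -/
theorem approxPts_const_mul_ae_le {S : Set K} {r : InfinitePlace K → K → ℝ} {w₀ : InfinitePlace K}
    (hr : ∀ w γ, 0 ≤ r w γ) (hv : RadiusVanishes S r w₀) (hper : ∀ a : 𝓞 K, TranslateStable S r a)
    (hu : ∀ u : (𝓞 K)ˣ, MulStable S r (u : K)) (M : ℝ) :
    approxPts S (fun w γ => M * r w γ) ≤ᵐ[volume] approxPts S r := by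
  wlog hM : 1 ≤ M generalizing M
  · refine EventuallyLE.trans (ae_le_of_subset ?_) (this 1 le_rfl)
    exact approxPts_mono subset_rfl fun w γ _ =>
      mul_le_mul_of_nonneg_right (not_le.1 hM).le (hr w γ)
  obtain ⟨u, hu1⟩ := exists_unit_forall_mul_le_one w₀ M
  have hu0 : (u : K) ≠ 0 := by simp
  have hpos : 0 < w₀ (u : K) * M := mul_pos (InfinitePlace.pos_iff.2 hu0) (by linarith)
  set f := mulMixed (u : K)
  have h1 : approxPts S (fun w γ => M * r w γ) ≤ᵐ[volume] f ⁻¹' approxPts S r := by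
    refine EventuallyLE.trans (ae_le_of_subset fun x hx => ?_)
      ((quasiMeasurePreserving_of_surjective f (mulMixed_surjective hu0)).preimage_mono_ae
        (approxPts_update_ae_le hr hv hpos))
    refine mul_mem_approxPts hu0 (fun γ hγ => ⟨(hu u γ hγ).1, fun w => ?_⟩) hx
    rw [(hu u γ hγ).2 w]
    split_ifs with hw
    · rw [hw, mul_assoc]
    · rw [← mul_assoc]
      exact mul_le_of_le_one_left (hr w γ) (hu1 w hw)
  have h2 : approxPts S r ⊆ approxPts S (fun w γ => M * r w γ) :=
    approxPts_mono subset_rfl fun w γ _ => le_mul_of_one_le_left (hr w γ) hM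
  -- Multiplication by `u` preserves the measure modulo the lattice, so the inclusions
  -- `approxPts S r ⊆ approxPts S (M r) ⊆ f ⁻¹' approxPts S r` are equalities almost everywhere.
  refine h1.trans (ae_eq_preimage_of_ae_le _ (measurableSet_approxPts S r)
    (approxPts_periodic hper) f (mulMixed_surjective hu0) (mulMixed_mem (u : 𝓞 K))
    ((ae_le_of_subset h2).trans h1)).symm.le

/-- Pigeonhole: modulo the lattice the powers `π⁻¹ ^ n` are distinct points of a bounded set, so
two of them are close to each other. -/
theorem exists_small_mem_inv_pow {π : 𝓞 K} (hπ : π ≠ 0) (hπ' : ¬ IsUnit π) {ε : ℝ} (hε : 0 < ε) :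
    ∃ β : K, β ≠ 0 ∧ (∃ n : ℕ, ∃ b : 𝓞 K, (π : K) ^ n * β = b) ∧
      ∀ w : InfinitePlace K, w β ≤ ε := by
  have hπ0 : (π : K) ≠ 0 := by simpa using hπ
  obtain ⟨F, hFb, -, hF⟩ := exists_bounded_fundamentalDomain (mixedEmbedding.integerLattice K)
    (volume : Measure (mixedSpace K))
  have h1 : ∀ n : ℕ, ∃ a : 𝓞 K, mixedEmbedding K ((π : K)⁻¹ ^ n - a) ∈ F := by
    intro n
    obtain ⟨_, ⟨a, rfl⟩, ha⟩ := hF (mixedEmbedding K ((π : K)⁻¹ ^ n))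
    exact ⟨a, by rw [map_sub]; exact ha⟩
  choose a ha using h1
  obtain ⟨x, -, φ, hφ, hx⟩ := tendsto_subseq_of_bounded hFb ha
  obtain ⟨N, hN⟩ := Metric.cauchySeq_iff.1 hx.cauchySeq ε hε
  have hd := hN (N + 1) N.le_succ N le_rfl
  have hlt : φ N < φ (N + 1) := hφ N.lt_succ_self
  obtain ⟨j, hj⟩ := Nat.exists_eq_add_of_lt hlt
  set n := φ N
  set m := φ (N + 1)
  refine ⟨((π : K)⁻¹ ^ m - a m) - ((π : K)⁻¹ ^ n - a n), fun h0 => hπ' ?_, ⟨m, ?_⟩, fun w => ?_⟩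
  · refine IsUnit.of_mul_eq_one (π ^ j + (a m - a n) * π ^ (n + j)) ?_
    apply RingOfIntegers.ext
    push_cast
    have h2 : (π : K)⁻¹ ^ m - (π : K)⁻¹ ^ n = a m - a n := by linear_combination h0
    rw [← h2, hj]
    simp only [inv_pow]
    field_simp
    ring
  · refine ⟨1 - π ^ (j + 1) + (a n - a m) * π ^ m, ?_⟩
    push_cast
    rw [hj]
    simp only [inv_pow]
    field_simp
    ring
  · rw [← normAtPlace_apply, map_sub, ← Real.norm_of_nonneg (normAtPlace_nonneg _ _)]
    rw [Function.comp, Function.comp, dist_eq_norm] at hd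
    refine le_trans ?_ hd.le
    rw [norm_eq_sup'_normAtPlace, Real.norm_of_nonneg (normAtPlace_nonneg _ _)]
    exact Finset.le_sup' (fun w => normAtPlace w _) (Finset.mem_univ w)

/-- The image of `𝓞 K[1/π]` in `ℝ^s × ℂ^t` is dense if `π` is not a unit: it contains nonzero
elements `β` that are small at all infinite places, and with `β` the lattice `β 𝓞 K`. -/
theorem dense_iUnion_inv_pow {π : 𝓞 K} (hπ : π ≠ 0) (hπ' : ¬ IsUnit π) :
    Dense {v : mixedSpace K | ∃ n : ℕ,
      (mulMixed (π : K))^[n] v ∈ mixedEmbedding.integerLattice K} := by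
  obtain ⟨F, hFb, -, hF⟩ := exists_bounded_fundamentalDomain (mixedEmbedding.integerLattice K)
    (volume : Measure (mixedSpace K))
  obtain ⟨C, hC0, hC⟩ := hFb.exists_pos_norm_le
  refine Metric.dense_iff.2 fun y ε hε => ?_
  obtain ⟨β, hβ, ⟨n, b, hb⟩, hβε⟩ :=
    exists_small_mem_inv_pow hπ hπ' (ε := ε / (2 * C)) (by positivity)
  obtain ⟨_, ⟨a, rfl⟩, ha⟩ := hF (mixedEmbedding K β⁻¹ * y)
  change mixedEmbedding K β⁻¹ * y - mixedEmbedding K a ∈ F at ha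
  refine ⟨mixedEmbedding K (β * a), ?_, n, ?_⟩
  · have h1 : y - mixedEmbedding K (β * a) =
        mixedEmbedding K β * (mixedEmbedding K β⁻¹ * y - mixedEmbedding K a) := by
      rw [mul_sub, ← mul_assoc, ← map_mul, mul_inv_cancel₀ hβ, map_one, one_mul, map_mul]
    rw [Metric.mem_ball, dist_comm, dist_eq_norm, h1, norm_eq_sup'_normAtPlace,
      Finset.sup'_lt_iff]
    intro w _
    rw [map_mul, normAtPlace_apply]
    have h2 : normAtPlace w (mixedEmbedding K β⁻¹ * y - mixedEmbedding K a) ≤ C := by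
      refine le_trans ?_ (hC _ ha)
      rw [norm_eq_sup'_normAtPlace]
      exact Finset.le_sup' (fun w => normAtPlace w _) (Finset.mem_univ w)
    calc w β * normAtPlace w (mixedEmbedding K β⁻¹ * y - mixedEmbedding K a)
        ≤ ε / (2 * C) * C := mul_le_mul (hβε w) h2 (normAtPlace_nonneg _ _) (by positivity)
      _ < ε := by field_simp; linarith
  · rw [mulMixed_iterate, ← map_mul]
    refine mem_integerLattice.2 ⟨b * a, ?_⟩
    rw [← mul_assoc, hb]
    exact congrArg _ (map_mul (algebraMap (𝓞 K) K) b a)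

/-- The zero-one law for data stable under multiplication by a nonunit `π`: after a change of the
radii by a constant factor, `approxPts S r` is invariant under the ergodic endomorphism `x ↦ π x`.
-/
theorem approxPts_const_of_mulStable {S : Set K} {r : InfinitePlace K → K → ℝ}
    {w₀ : InfinitePlace K}
    (hr : ∀ w γ, 0 ≤ r w γ) (hv : RadiusVanishes S r w₀) (hper : ∀ a : 𝓞 K, TranslateStable S r a)
    (hu : ∀ u : (𝓞 K)ˣ, MulStable S r (u : K)) {π : 𝓞 K} (hπ : π ≠ 0) (hπ' : ¬ IsUnit π)
    (hπr : MulStable S r (π : K)) : EventuallyConst (approxPts S r) (ae volume) := by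
  have hπ0 : (π : K) ≠ 0 := by simpa using hπ
  refine ae_const_of_ae_le_preimage (mixedEmbedding.integerLattice K) (measurableSet_approxPts S r)
    (approxPts_periodic hper) (mulMixed (π : K)) (mulMixed_surjective hπ0) (mulMixed_mem π)
    (dense_iUnion_inv_pow hπ hπ') ?_
  refine EventuallyLE.trans (ae_le_of_subset fun x hx => ?_)
      ((quasiMeasurePreserving_of_surjective _ (mulMixed_surjective hπ0)).preimage_mono_ae
        (approxPts_const_mul_ae_le hr hv hper hu (∑ w : InfinitePlace K, w (π : K))))
  refine mul_mem_approxPts hπ0 (fun γ hγ => ⟨(hπr γ hγ).1, fun w => ?_⟩) hx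
  rw [(hπr γ hγ).2 w]
  exact mul_le_mul_of_nonneg_right (Finset.single_le_sum (f := fun w : InfinitePlace K => w (π : K))
    (fun w _ => apply_nonneg w _) (Finset.mem_univ w)) (hr w γ)

end Multiplication

/-! ### Denominators and the zero-one law -/

section Denominators

variable {K : Type*} [Field K]

theorem mem_dnm {γ : K} {d : 𝓞 K} : d ∈ dnm γ ↔ ∃ b : 𝓞 K, (d : K) * γ = b := Iff.rfl

theorem mem_dnm_add {γ δ : K} {d : 𝓞 K} (h₁ : d ∈ dnm γ) (h₂ : d ∈ dnm δ) : d ∈ dnm (γ + δ) := by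
  obtain ⟨b, hb⟩ := h₁
  obtain ⟨c, hc⟩ := h₂
  exact ⟨b + c, by push_cast; rw [mul_add, hb, hc]⟩

theorem mem_dnm_mul {γ : K} {d e : 𝓞 K} : d ∈ dnm ((e : K) * γ) ↔ d * e ∈ dnm γ := by
  rw [mem_dnm, mem_dnm]
  push_cast
  simp only [mul_assoc]

theorem mem_dnm_neg {γ : K} {d : 𝓞 K} (h : d ∈ dnm γ) : d ∈ dnm (-γ) := by
  have := mem_dnm_mul (γ := γ) (d := d) (e := -1)
  push_cast at this
  rw [neg_one_mul] at this
  rw [this]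
  exact Ideal.mul_mem_right _ _ h

theorem mem_dnm_coe (d a : 𝓞 K) : d ∈ dnm (a : K) := ⟨d * a, by push_cast; rfl⟩

theorem dnm_add_coe (γ : K) (a : 𝓞 K) : dnm (γ + a) = dnm γ := by
  ext d
  refine ⟨fun h => ?_, fun h => mem_dnm_add h (mem_dnm_coe d a)⟩
  simpa using mem_dnm_add h (mem_dnm_neg (mem_dnm_coe d a))

/-- `γ` lies in `𝓞 K[1/π]`. -/
def IsPowDen (π : 𝓞 K) (γ : K) : Prop := ∃ k : ℕ, π ^ k ∈ dnm γ

/-- `γ` has a denominator coprime to `π`. -/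
def IsCoprimeDen (π : 𝓞 K) (γ : K) : Prop := ∃ d ∈ dnm γ, IsCoprime d π

variable {π : 𝓞 K} {γ δ τ : K}

theorem IsCoprimeDen.add (h₁ : IsCoprimeDen π γ) (h₂ : IsCoprimeDen π δ) :
    IsCoprimeDen π (γ + δ) := by
  obtain ⟨d, hd, hdc⟩ := h₁
  obtain ⟨e, he, hec⟩ := h₂
  exact ⟨d * e, mem_dnm_add (Ideal.mul_mem_right _ _ hd) (Ideal.mul_mem_left _ _ he),
    hdc.mul_left hec⟩

theorem IsCoprimeDen.mul (a : 𝓞 K) (h : IsCoprimeDen π γ) : IsCoprimeDen π ((a : K) * γ) := by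
  obtain ⟨d, hd, hdc⟩ := h
  exact ⟨d, mem_dnm_mul.2 (Ideal.mul_mem_right _ _ hd), hdc⟩

theorem isCoprimeDen_coe (a : 𝓞 K) : IsCoprimeDen π (a : K) :=
  ⟨1, mem_dnm_coe 1 a, isCoprime_one_left⟩

theorem IsPowDen.add_coe_mul (h : IsPowDen π γ) (a b : 𝓞 K) :
    IsPowDen π ((a : K) * γ + b) := by
  obtain ⟨k, hk⟩ := h
  exact ⟨k, mem_dnm_add (mem_dnm_mul.2 (Ideal.mul_mem_right _ _ hk)) (mem_dnm_coe _ b)⟩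

/-- An element of `𝓞 K[1/π]` with a denominator coprime to `π` is integral. -/
theorem one_mem_dnm (h₁ : IsPowDen π γ) (h₂ : IsCoprimeDen π γ) : 1 ∈ dnm γ := by
  obtain ⟨k, hk⟩ := h₁
  obtain ⟨d, hd, hdc⟩ := h₂
  obtain ⟨a, b, hab⟩ := hdc.pow_right (n := k)
  rw [← hab]
  exact Ideal.add_mem _ (Ideal.mul_mem_left _ _ hd) (Ideal.mul_mem_left _ _ hk)

theorem mem_dnm_of_one_mem {d : 𝓞 K} (h : 1 ∈ dnm ((d : K) * γ)) : d ∈ dnm γ := by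
  simpa using mem_dnm_mul.1 h

/-- The denominator of a sum whose summands have coprime denominators. -/
theorem dnm_add_eq_inf (hγ : IsCoprimeDen π γ) (hτ : IsPowDen π τ) :
    dnm (γ + τ) = dnm γ ⊓ dnm τ := by
  refine le_antisymm (fun d hd => ?_) fun d hd => mem_dnm_add hd.1 hd.2
  have h1 : d ∈ dnm γ := by
    obtain ⟨b, hb⟩ := hd
    refine mem_dnm_of_one_mem (one_mem_dnm (π := π) ?_ (hγ.mul d))
    convert hτ.add_coe_mul (-d) b using 1
    rw [← hb]
    push_cast
    ring
  exact ⟨h1, by simpa using mem_dnm_add hd (mem_dnm_neg h1)⟩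

theorem dnm_mul_eq {v : 𝓞 K} {k : ℕ} (hv : v ∣ π ^ k) (hγ : IsCoprimeDen π γ) :
    dnm ((v : K) * γ) = dnm γ := by
  ext d
  refine ⟨fun hd => ?_, fun hd => mem_dnm_mul.2 (Ideal.mul_mem_right _ _ hd)⟩
  obtain ⟨c, hc⟩ := hv
  refine mem_dnm_of_one_mem (one_mem_dnm ⟨k, mem_dnm_mul.2 ?_⟩ (hγ.mul d))
  have := Ideal.mul_mem_right c _ (mem_dnm_mul.1 hd)
  rwa [mul_assoc, ← hc, mul_comm] at this

theorem dnm_mul_add_eq {v : 𝓞 K} {k : ℕ} (hv : v ∣ π ^ k) (hγ : IsCoprimeDen π γ)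
    (hτ : IsPowDen π τ) : dnm ((v : K) * γ + τ) = dnm (γ + τ) := by
  rw [dnm_add_eq_inf (hγ.mul v) hτ, dnm_add_eq_inf hγ hτ, dnm_mul_eq hv hγ]

variable [NumberField K] {P : Ideal (𝓞 K)} {h : ℕ}

/-- Finiteness of the class group: some power of a prime ideal is principal. -/
theorem exists_prime_pow_principal : ∃ (P : Ideal (𝓞 K)) (h : ℕ) (π : 𝓞 K),
    P.IsPrime ∧ P ≠ ⊥ ∧ h ≠ 0 ∧ P ^ h = Ideal.span {π} := by
  obtain ⟨P, hP⟩ := Ideal.exists_maximal (𝓞 K)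
  have hP0 : P ≠ ⊥ := Ring.ne_bot_of_isMaximal_of_not_isField hP (RingOfIntegers.not_isField K)
  have h1 : ClassGroup.mk0 ⟨P, mem_nonZeroDivisors_of_ne_zero hP0⟩ ^
      Fintype.card (ClassGroup (𝓞 K)) = 1 := pow_card_eq_one
  rw [← map_pow, ClassGroup.mk0_eq_one_iff] at h1
  obtain ⟨π, hπ⟩ := h1
  exact ⟨P, _, π, hP.isPrime, hP0, Fintype.card_ne_zero, hπ⟩

/-- Every element of `K` is the sum of an element with a denominator coprime to `π` and an element
of `𝓞 K[1/π]`. -/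
theorem exists_add_eq (hP : P.IsPrime) (hP0 : P ≠ ⊥) (hh : h ≠ 0) (hπ : P ^ h = Ideal.span {π})
    (γ : K) : ∃ γ' τ : K, γ = γ' + τ ∧ IsCoprimeDen π γ' ∧ IsPowDen π τ := by
  obtain ⟨d, hd, hd0⟩ := Submodule.exists_mem_ne_zero_of_ne_bot (dnm_spec γ).1
  obtain ⟨m, e, hPe, hde⟩ := WfDvdMonoid.max_power_factor
    (a₀ := Ideal.span {d}) (by simpa [Ideal.span_singleton_eq_bot] using hd0)
    (Ideal.prime_of_isPrime hP0 hP).irreducible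
  have hcop : IsCoprime e (Ideal.span {π}) := by
    rw [← hπ]
    refine IsCoprime.pow_right ?_
    rw [Ideal.isCoprime_iff_sup_eq]
    by_contra hne
    have hPm : P.IsMaximal := hP.isMaximal hP0
    have := hPm.eq_of_le hne le_sup_right
    exact hPe (Ideal.dvd_iff_le.2 (le_sup_left.trans this.ge))
  obtain ⟨f, hf, g, hg, hfg⟩ := (Ideal.isCoprime_iff_exists).1 hcop
  obtain ⟨c, rfl⟩ := Ideal.mem_span_singleton'.1 hg
  have hfπ : IsCoprime f π := ⟨1, c, by rw [one_mul, hfg]⟩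
  obtain ⟨a, b, hab⟩ := hfπ.pow_right (n := m)
  have hmem : π ^ m * f ∈ dnm γ := by
    refine (Ideal.span_singleton_le_iff_mem _).2 hd ?_
    rw [hde]
    refine Ideal.mul_mem_mul (Ideal.pow_le_pow_right (Nat.le_mul_of_pos_left m
      (Nat.pos_of_ne_zero hh)) ?_) hf
    rw [pow_mul, hπ, Ideal.span_singleton_pow]
    exact Ideal.mem_span_singleton_self _
  refine ⟨((b * π ^ m : 𝓞 K) : K) * γ, ((a * f : 𝓞 K) : K) * γ, ?_, ⟨f, mem_dnm_mul.2 ?_, hfπ⟩,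
    m, mem_dnm_mul.2 ?_⟩
  · rw [← add_mul, ← map_add, add_comm, hab, map_one, one_mul]
  · convert Ideal.mul_mem_left _ b hmem using 1
    ring
  · convert Ideal.mul_mem_left _ a hmem using 1
    ring

/-- For `τ ∈ 𝓞 K[1/π]` the ideal `dnm τ` is a power of `P`. If it does not contain `π ^ k`, it is
contained in `(π ^ k)` and hence in `dnm σ`, so that adding `σ` does not change it. -/
theorem dnm_add_eq_of_notMem (hP : P.IsPrime) (hP0 : P ≠ ⊥)
    (hπ : P ^ h = Ideal.span {π}) {k : ℕ} {σ : K} (hτ : IsPowDen π τ) (hτk : π ^ k ∉ dnm τ)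
    (hσ : π ^ k ∈ dnm σ) : dnm (τ + σ) = dnm τ := by
  have key : ∀ δ : K, IsPowDen π δ → π ^ k ∉ dnm δ → dnm δ ≤ Ideal.span {π ^ k} := by
    intro δ ⟨N, hN⟩ hδk
    have h1 : dnm δ ∣ P ^ (h * N) := by
      rw [pow_mul, hπ, Ideal.span_singleton_pow, Ideal.dvd_span_singleton]
      exact hN
    obtain ⟨i, -, hi⟩ := (dvd_prime_pow (Ideal.prime_of_isPrime hP0 hP) _).1 h1
    rw [associated_iff_eq] at hi
    have h2 : P ^ (h * k) = Ideal.span {π ^ k} := by rw [pow_mul, hπ, Ideal.span_singleton_pow]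
    rw [← h2, hi]
    refine Ideal.pow_le_pow_right ?_
    by_contra! hik
    refine hδk ?_
    rw [hi]
    refine Ideal.pow_le_pow_right hik.le ?_
    rw [h2]
    exact Ideal.mem_span_singleton_self _
  have hle : ∀ δ : K, dnm δ ≤ Ideal.span {π ^ k} → ∀ ρ : K, π ^ k ∈ dnm ρ → dnm δ ≤ dnm ρ :=
    fun δ h1 ρ h2 => h1.trans ((Ideal.span_singleton_le_iff_mem _).2 h2)
  have h1 := key τ hτ hτk
  refine le_antisymm (fun d hd => ?_) fun d hd => mem_dnm_add hd (hle τ h1 σ hσ hd)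
  have h2 : dnm (τ + σ) ≤ Ideal.span {π ^ k} := by
    refine key _ ?_ fun hk => hτk ?_
    · obtain ⟨N, hN⟩ := hτ
      exact ⟨N + k, mem_dnm_add (by rw [pow_add]; exact Ideal.mul_mem_right _ _ hN)
        (by rw [pow_add]; exact Ideal.mul_mem_left _ _ hσ)⟩
    · simpa using mem_dnm_add hk (mem_dnm_neg hσ)
  simpa using mem_dnm_add hd (mem_dnm_neg (hle _ h2 σ hσ hd))

omit [NumberField K] in
theorem exists_ne_zero_forall_mem (F : Set (Ideal (𝓞 K))) (hF : F.Finite) (h0 : ∀ n ∈ F, n ≠ ⊥) :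
    ∃ d : 𝓞 K, d ≠ 0 ∧ ∀ n ∈ F, d ∈ n := by
  have h1 : ∏ n ∈ hF.toFinset, n ≠ ⊥ := by
    rw [← Ideal.zero_eq_bot, Finset.prod_ne_zero_iff]
    exact fun n hn => h0 n (hF.mem_toFinset.1 hn)
  obtain ⟨d, hd, hd0⟩ := Submodule.exists_mem_ne_zero_of_ne_bot h1
  exact ⟨d, hd0, fun n hn => Ideal.prod_le_inf.trans (Finset.inf_le (hF.mem_toFinset.2 hn)) hd⟩

variable {r : InfinitePlace K → Ideal (𝓞 K) → ℝ} {Q : Set (Ideal (𝓞 K))} {w₀ : InfinitePlace K}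

/-- The points approximated by the `γ` with a denominator coprime to `π`, with the radii attached to
the denominator of `γ + τ`. -/
theorem approxPts_coprimeDen_const (hr : ∀ w n, 0 ≤ r w n)
    (hv : ∀ ε > 0, {n ∈ Q | n ≠ ⊥ ∧ ε ≤ r w₀ n}.Finite) (hπ0 : π ≠ 0) (hπu : ¬ IsUnit π)
    (hτ : IsPowDen π τ) :
    EventuallyConst (approxPts {γ | IsCoprimeDen π γ ∧ dnm (γ + τ) ∈ Q}
      (fun w γ => r w (dnm (γ + τ)))) (ae volume) := by
  have hmul : ∀ (v : 𝓞 K) (k : ℕ), v ∣ π ^ k →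
      MulStable {γ | IsCoprimeDen π γ ∧ dnm (γ + τ) ∈ Q} (fun w γ => r w (dnm (γ + τ)))
        (v : K) := by
    intro v k hvk γ hγ
    have := dnm_mul_add_eq hvk hγ.1 hτ
    exact ⟨⟨hγ.1.mul v, by rw [this]; exact hγ.2⟩, fun w => by simp only [this]⟩
  refine approxPts_const_of_mulStable (w₀ := w₀) (fun w γ => hr w _) (fun ε hε => ?_)
    (fun a γ hγ => ?_) (fun u => hmul u 0 u.isUnit.dvd) hπ0 hπu (hmul π 1 (by rw [pow_one]))
  · -- A common denominator of the finitely many `γ + τ` in question and of `τ` serves for `γ`.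
    obtain ⟨d, hd0, hd⟩ := exists_ne_zero_forall_mem _ (hv ε hε) fun n hn => hn.2.1
    obtain ⟨e, he, he0⟩ := Submodule.exists_mem_ne_zero_of_ne_bot (dnm_spec τ).1
    refine ⟨∑ n ∈ (hv ε hε).toFinset, ∑ w, r w n, d * e, mul_ne_zero hd0 he0, fun γ hγ hεγ => ?_⟩
    have hn : dnm (γ + τ) ∈ {n ∈ Q | n ≠ ⊥ ∧ ε ≤ r w₀ n} := ⟨hγ.2, (dnm_spec _).1, hεγ⟩
    refine ⟨?_, fun w => ?_⟩
    · simpa using mem_dnm_add (Ideal.mul_mem_right e _ (hd _ hn))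
        (mem_dnm_neg (Ideal.mul_mem_left _ d he))
    · exact (Finset.single_le_sum (f := fun w => r w (dnm (γ + τ))) (fun w _ => hr w _)
        (Finset.mem_univ w)).trans (Finset.single_le_sum (f := fun n => ∑ w, r w n)
          (fun n _ => Finset.sum_nonneg fun w _ => hr w n) ((hv ε hε).mem_toFinset.2 hn))
  · have : dnm (γ + a + τ) = dnm (γ + τ) := by rw [add_right_comm, dnm_add_coe]
    exact ⟨⟨hγ.1.add (isCoprimeDen_coe a), by rw [this]; exact hγ.2⟩, fun w => by simp only [this]⟩

/-- The elements of `K` whose `𝓞 K[1/π]`-part is not killed by `π ^ k`. -/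
def highLevel (π : 𝓞 K) (k : ℕ) : Set K :=
  {γ | ∀ γ' τ : K, γ = γ' + τ → IsCoprimeDen π γ' → π ^ k ∉ dnm τ}

omit [NumberField K] in
theorem add_mem_highLevel {k : ℕ} {σ : K} (hσ : π ^ k ∈ dnm σ) (hγ : γ ∈ highLevel π k) :
    γ + σ ∈ highLevel π k := fun γ' τ h h' hτ =>
  hγ γ' (τ - σ) (by rw [← add_sub_assoc, ← h, add_sub_cancel_right]) h' (by
    rw [sub_eq_add_neg]
    exact mem_dnm_add hτ (mem_dnm_neg hσ))

theorem dnm_add_of_mem_highLevel (hP : P.IsPrime) (hP0 : P ≠ ⊥) (hh : h ≠ 0)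
    (hπ : P ^ h = Ideal.span {π}) {k : ℕ} {σ : K} (hσ : π ^ k ∈ dnm σ) (hγ : γ ∈ highLevel π k) :
    dnm (γ + σ) = dnm γ := by
  obtain ⟨γ', τ, rfl, hγ', hτ⟩ := exists_add_eq hP hP0 hh hπ γ
  have hτk := hγ γ' τ rfl hγ'
  have h1 := dnm_add_eq_of_notMem hP hP0 hπ hτ hτk hσ
  have hτσ : IsPowDen π (τ + σ) := by
    obtain ⟨N, hN⟩ := hτ
    exact ⟨N, by rw [h1]; exact hN⟩
  rw [add_assoc, dnm_add_eq_inf hγ' hτσ, dnm_add_eq_inf hγ' hτ, h1]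

/-- The zero-one law for the `γ` with `dnm γ ∈ Q`, when the radii at a fixed place go to zero along
`Q`. Either the `γ` of one class modulo the elements with denominator coprime to `π` approximate
almost all points, or for every `k` all but a null set of the approximable points are approximated
by elements of `highLevel π k`; the latter are stable under translation by `π⁻ᵏ 𝓞 K`. -/
theorem approxPts_dnm_const (hr : ∀ w n, 0 ≤ r w n)
    (hv : ∀ ε > 0, {n ∈ Q | n ≠ ⊥ ∧ ε ≤ r w₀ n}.Finite) :
    EventuallyConst (approxPts {γ : K | dnm γ ∈ Q} (fun w γ => r w (dnm γ))) (ae volume) := by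
  obtain ⟨P, h, π, hP, hP0, hh, hπ⟩ := exists_prime_pow_principal (K := K)
  have hπ0 : π ≠ 0 := by
    rintro rfl
    rw [Ideal.span_singleton_eq_bot.2 rfl] at hπ
    exact hP0 (eq_zero_of_pow_eq_zero hπ)
  have hπK : (π : K) ≠ 0 := by simpa using hπ0
  have hπu : ¬ IsUnit π := by
    rw [← Ideal.span_singleton_eq_top, ← hπ, Ideal.pow_eq_top_iff]
    simp [hP.ne_top, hh]
  set A := approxPts {γ : K | dnm γ ∈ Q} (fun w γ => r w (dnm γ))
  have hAm : MeasurableSet A := measurableSet_approxPts _ _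
  let E : K → Set (mixedSpace K) := fun τ =>
    approxPts {γ | IsCoprimeDen π γ ∧ dnm (γ + τ) ∈ Q} (fun w γ => r w (dnm (γ + τ)))
  have hE : ∀ τ, IsPowDen π τ → EventuallyConst (E τ) (ae volume) := fun τ hτ =>
    approxPts_coprimeDen_const hr hv hπ0 hπu hτ
  have hEA : ∀ τ : K, (· - mixedEmbedding K τ) ⁻¹' E τ ⊆ A := by
    intro τ x hx
    have := add_mem_approxPts (S' := {γ : K | dnm γ ∈ Q}) (r' := fun w γ => r w (dnm γ)) τ
      (fun γ hγ => ⟨hγ.2, fun w => le_rfl⟩) hx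
    simpa using this
  have hshift : ∀ (τ : K), Measure.QuasiMeasurePreserving
      (· - mixedEmbedding K τ : mixedSpace K → mixedSpace K) volume volume := fun τ =>
    (measurePreserving_sub_right volume _).quasiMeasurePreserving
  by_cases hfull : ∃ τ, IsPowDen π τ ∧ E τ =ᵐ[volume] Set.univ
  · obtain ⟨τ, -, hτ⟩ := hfull
    rw [eventuallyConst_set']
    right
    have h1 := (hshift τ).preimage_ae_eq hτ
    rw [Set.preimage_univ] at h1
    exact (ae_le_of_subset (Set.subset_univ _)).antisymm
      (h1.symm.le.trans (ae_le_of_subset (hEA τ)))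
  have hnull : ∀ τ, IsPowDen π τ → E τ =ᵐ[volume] (∅ : Set (mixedSpace K)) := fun τ hτ =>
    (eventuallyConst_set'.1 (hE τ hτ)).resolve_right fun h => hfull ⟨τ, hτ, h⟩
  have hlevel : ∀ k : ℕ, A =ᵐ[volume]
      approxPts ({γ : K | dnm γ ∈ Q} ∩ highLevel π k) (fun w γ => r w (dnm γ)) := by
    intro k
    refine EventuallyLE.antisymm ?_ (ae_le_of_subset
      (approxPts_mono Set.inter_subset_left fun w γ _ => le_rfl))
    have hpow : Ideal.span {π ^ k} ≠ ⊥ := by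
      rw [Ne, Ideal.span_singleton_eq_bot]
      exact pow_ne_zero k hπ0
    have hfinite : Finite (𝓞 K ⧸ Ideal.span {π ^ k}) := Ideal.finiteQuotientOfFreeOfNeBot _ hpow
    -- Representatives `t q` of `π⁻ᵏ 𝓞 K` modulo `𝓞 K`.
    let t : 𝓞 K ⧸ Ideal.span {π ^ k} → K := fun q => ((π : K) ^ k)⁻¹ * (Quotient.out q : 𝓞 K)
    have ht : ∀ q, IsPowDen π (t q) := fun q => ⟨k, Quotient.out q, by
      push_cast
      rw [mul_inv_cancel_left₀ (pow_ne_zero _ hπK)]⟩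
    have hae : ∀ᵐ x : mixedSpace K, ∀ q, x - mixedEmbedding K (t q) ∉ E (t q) :=
      ae_all_iff.2 fun q => by
        have h1 := (hshift (t q)).preimage_ae_eq (hnull _ (ht q))
        filter_upwards [h1.mem_iff] with x hx hxE
        exact hx.1 hxE
    filter_upwards [hae] with x hx hxA
    by_contra hfin
    refine hxA (((Set.not_infinite.1 hfin).union (Set.finite_iUnion fun q =>
      (Set.not_infinite.1 (hx q)).preimage
        (sub_left_injective (b := t q)).injOn)).subset fun γ hγ => ?_)
    by_cases hγk : γ ∈ highLevel π k
    · exact .inl ⟨⟨hγ.1, hγk⟩, hγ.2⟩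
    right
    simp only [highLevel, Set.mem_ofPred, not_forall, not_not] at hγk
    obtain ⟨γ', τ, rfl, hγ', b, hb⟩ := hγk
    obtain ⟨c, hc⟩ := Ideal.mem_span_singleton'.1
      (Ideal.Quotient.eq.1 (Quotient.out_eq (Ideal.Quotient.mk (Ideal.span {π ^ k}) b)))
    have hc' : (c : K) * (π : K) ^ k =
        (Quotient.out (Ideal.Quotient.mk (Ideal.span {π ^ k}) b) : 𝓞 K) - b := by
      rw [← map_pow, ← map_mul, hc, map_sub]
    have htq : t (Ideal.Quotient.mk _ b) = τ + c := by
      simp only [t]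
      rw [inv_mul_eq_iff_eq_mul₀ (pow_ne_zero _ hπK), mul_add, ← map_pow, hb, map_pow,
        mul_comm _ (c : K), hc']
      ring
    refine Set.mem_iUnion.2 ⟨Ideal.Quotient.mk _ b, ⟨?_, ?_⟩, fun w => ?_⟩
    · rw [htq]
      convert hγ'.add (isCoprimeDen_coe (-c)) using 1
      push_cast
      ring
    · rw [sub_add_cancel]
      exact hγ.1
    · simp only [sub_add_cancel]
      rw [map_sub (mixedEmbedding K), sub_sub_sub_cancel_right]
      exact hγ.2 w
  refine ae_const_of_dense_translations (mixedEmbedding.integerLattice K) hAm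
    (approxPts_periodic fun a γ hγ => ?_) ((dense_iUnion_inv_pow hπ0 hπu).mono ?_)
  · simp only [Set.mem_ofPred, dnm_add_coe]
    exact ⟨hγ, fun _ => trivial⟩
  rintro v ⟨k, hk⟩
  obtain ⟨b, hb⟩ := mem_integerLattice.1 hk
  rw [mulMixed_iterate] at hb
  obtain ⟨σ, hσ, rfl⟩ : ∃ σ : K, π ^ k ∈ dnm σ ∧ mixedEmbedding K σ = v := by
    refine ⟨((π : K) ^ k)⁻¹ * b, ⟨b, ?_⟩, ?_⟩
    · push_cast
      rw [mul_inv_cancel_left₀ (pow_ne_zero _ hπK)]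
    · rw [map_mul, hb, ← mul_assoc, ← map_mul, inv_mul_cancel₀ (pow_ne_zero _ hπK),
        map_one, one_mul]
  have hstab : ∀ σ : K, π ^ k ∈ dnm σ → ∀ x ∈ approxPts ({γ : K | dnm γ ∈ Q} ∩ highLevel π k)
      (fun w γ => r w (dnm γ)), x + mixedEmbedding K σ ∈
        approxPts ({γ : K | dnm γ ∈ Q} ∩ highLevel π k) (fun w γ => r w (dnm γ)) := by
    intro σ hσ x hx
    refine add_mem_approxPts σ (fun γ hγ => ?_) hx
    have h1 := dnm_add_of_mem_highLevel hP hP0 hh hπ hσ hγ.2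
    exact ⟨⟨by simpa only [Set.mem_ofPred, h1] using hγ.1, add_mem_highLevel hσ hγ.2⟩,
      fun w => by simp only [h1, le_rfl]⟩
  have h1 : (mixedEmbedding K σ + ·) ⁻¹' approxPts ({γ : K | dnm γ ∈ Q} ∩ highLevel π k)
      (fun w γ => r w (dnm γ)) = approxPts ({γ : K | dnm γ ∈ Q} ∩ highLevel π k)
      (fun w γ => r w (dnm γ)) := by
    ext x
    refine ⟨fun hx => ?_, fun hx => ?_⟩
    · simpa using hstab (-σ) (mem_dnm_neg hσ) _ hx
    · simpa [add_comm] using hstab σ hσ _ hx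
  have h2 := (measurePreserving_add_left volume
    (mixedEmbedding K σ)).quasiMeasurePreserving.preimage_ae_eq (hlevel k)
  rw [h1] at h2
  exact h2.trans (hlevel k).symm

end Denominators

section ZeroOne

variable {K : Type*} [Field K] [NumberField K]

/-- The zero-one law when the smallest of the radii attached to `n` goes to zero as the norm of `n`
grows, proved by sorting the ideals by the place at which their radius is smallest. -/
theorem approxPts_univ_const {r : InfinitePlace K → Ideal (𝓞 K) → ℝ} (hr : ∀ w n, 0 ≤ r w n)
    (hv : ∀ ε > 0, ∃ N : ℕ, ∀ n : Ideal (𝓞 K), N ≤ Ideal.absNorm n → ∃ w, r w n < ε) :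
    EventuallyConst (approxPts (Set.univ : Set K) (fun w γ => r w (dnm γ))) (ae volume) := by
  let Q : InfinitePlace K → Set (Ideal (𝓞 K)) := fun w₀ => {n | ∀ w, r w₀ n ≤ r w n}
  have hQ : ∀ w₀, EventuallyConst (approxPts {γ : K | dnm γ ∈ Q w₀} (fun w γ => r w (dnm γ)))
      (ae volume) := by
    refine fun w₀ => approxPts_dnm_const (w₀ := w₀) hr fun ε hε => ?_
    obtain ⟨N, hN⟩ := hv ε hε
    refine (Ideal.finite_setOfPred_absNorm_le N).subset fun n hn => ?_
    by_contra hlt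
    obtain ⟨w, hw⟩ := hN n (not_le.1 hlt).le
    exact (hn.2.2.trans (hn.1 w)).not_gt hw
  have hsub : ∀ w₀, approxPts {γ : K | dnm γ ∈ Q w₀} (fun w γ => r w (dnm γ)) ⊆
      approxPts Set.univ (fun w γ => r w (dnm γ)) := fun w₀ =>
    approxPts_mono (Set.subset_univ _) fun _ _ _ => le_rfl
  rw [eventuallyConst_set']
  by_cases hfull : ∃ w₀,
      approxPts {γ : K | dnm γ ∈ Q w₀} (fun w γ => r w (dnm γ)) =ᵐ[volume] Set.univ
  · obtain ⟨w₀, hw⟩ := hfull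
    exact .inr ((ae_le_of_subset (Set.subset_univ _)).antisymm
      (hw.symm.le.trans (ae_le_of_subset (hsub w₀))))
  · left
    have hnull : ∀ w₀, approxPts {γ : K | dnm γ ∈ Q w₀} (fun w γ => r w (dnm γ)) =ᵐ[volume]
        (∅ : Set (mixedSpace K)) := fun w₀ =>
      (eventuallyConst_set'.1 (hQ w₀)).resolve_right fun h => hfull ⟨w₀, h⟩
    rw [ae_eq_empty]
    refine measure_mono_null (fun x hx => ?_)
      (measure_iUnion_null fun w₀ => ae_eq_empty.1 (hnull w₀))
    by_contra hnot
    simp only [Set.mem_iUnion, not_exists] at hnot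
    refine hx ((Set.finite_iUnion fun w₀ => Set.not_infinite.1 (hnot w₀)).subset fun γ hγ => ?_)
    obtain ⟨w₀, hw⟩ := Finite.exists_min fun w => r w (dnm γ)
    exact Set.mem_iUnion.2 ⟨w₀, hw, hγ.2⟩

theorem exists_lt_of_tendsto_bigPsi {ψ : InfinitePlace K → Ideal (𝓞 K) → ℝ≥0}
    (hψ : Tendsto (bigPsi ψ) (comap (Ideal.absNorm : Ideal (𝓞 K) → ℕ) atTop) (𝓝 0))
    {η : ℝ≥0} (hη : 0 < η) :
    ∃ N : ℕ, ∀ n : Ideal (𝓞 K), N ≤ Ideal.absNorm n → ∃ w, ψ w n < η := by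
  have h1 := hψ.eventually_lt_const
    (u := (∏ _w : {w : InfinitePlace K // IsReal w}, η) *
      ∏ _w : {w : InfinitePlace K // IsComplex w}, η ^ 2) (by positivity)
  obtain ⟨N, hN⟩ := eventually_atTop.1 (eventually_comap.1 h1)
  refine ⟨N, fun n hn => ?_⟩
  by_contra! hle
  refine (hN _ hn n rfl).not_ge (mul_le_mul' ?_ ?_)
  · exact Finset.prod_le_prod' fun w _ => hle w
  · exact Finset.prod_le_prod' fun w _ => pow_le_pow_left' (hle w) 2

/-- The statement for a notion `good` of approximation given by radii at the infinite places. -/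
theorem volume_approxSet {D : Set (mixedSpace K)} {good : mixedSpace K → K → Prop}
    {r : InfinitePlace K → Ideal (𝓞 K) → ℝ} (hr : ∀ w n, 0 ≤ r w n)
    (hv : ∀ ε > 0, ∃ N : ℕ, ∀ n : Ideal (𝓞 K), N ≤ Ideal.absNorm n → ∃ w, r w n < ε)
    (hgood : ∀ x γ, good x γ ↔ ∀ w, normAtPlace w (x - mixedEmbedding K γ) ≤ r w (dnm γ)) :
    volume (approxSet D good) = 0 ∨ volume (approxSet D good) = volume D := by
  have h : approxSet D good = D ∩ approxPts Set.univ (fun w γ => r w (dnm γ)) := by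
    ext x
    simp [approxSet, approxPts, hgood]
  rw [h]
  refine (eventuallyConst_set'.1 (approxPts_univ_const hr hv)).imp (fun h0 => ?_) fun h1 => ?_
  · exact measure_mono_null Set.inter_subset_right (ae_eq_empty.1 h0)
  · refine measure_congr ?_
    simpa using (EventuallyEq.refl (ae volume) D).inter h1

end ZeroOne

end ZeroOneLaw

end

theorem mainTheorem2 {K : Type*} [Field K] [NumberField K]
    (D : Set (mixedEmbedding.mixedSpace K))
    (hD : MeasureTheory.IsAddFundamentalDomain (mixedEmbedding.integerLattice K) D
      MeasureTheory.volume)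
    (ψ : InfinitePlace K → Ideal (𝓞 K) → ℝ≥0)
    (hψ : Filter.Tendsto (ZeroOneLaw.bigPsi ψ)
      (Filter.comap (Ideal.absNorm : Ideal (𝓞 K) → ℕ) Filter.atTop) (nhds 0)) :
    (MeasureTheory.volume (ZeroOneLaw.approxSet D (ZeroOneLaw.IsGoodApprox ψ)) = 0 ∨
      MeasureTheory.volume (ZeroOneLaw.approxSet D (ZeroOneLaw.IsGoodApprox ψ)) =
        MeasureTheory.volume D) ∧
    (MeasureTheory.volume (ZeroOneLaw.approxSet D (ZeroOneLaw.IsGoodApproxUsual ψ)) = 0 ∨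
      MeasureTheory.volume (ZeroOneLaw.approxSet D (ZeroOneLaw.IsGoodApproxUsual ψ)) =
        MeasureTheory.volume D) := by
  constructor
  · -- Bounding the square of the absolute value by `ψ` is bounding the absolute value by `√ψ`.
    refine ZeroOneLaw.volume_approxSet
      (r := fun w n => if IsReal w then (ψ w n : ℝ) else √(ψ w n : ℝ))
      (fun w n => by positivity) (fun ε hε => ?_) fun x γ => ?_
    · lift ε to ℝ≥0 using hε.le
      have hε' : 0 < ε := by exact_mod_cast hε
      obtain ⟨N, hN⟩ := ZeroOneLaw.exists_lt_of_tendsto_bigPsi hψ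
        (lt_min hε' (pow_pos hε' 2))
      refine ⟨N, fun n hn => ?_⟩
      obtain ⟨w, hw⟩ := hN n hn
      refine ⟨w, ?_⟩
      split_ifs with h
      · exact_mod_cast hw.trans_le (min_le_left _ _)
      · rw [Real.sqrt_lt' hε]
        exact_mod_cast hw.trans_le (min_le_right _ _)
    · constructor
      · rintro ⟨h₁, h₂⟩ w
        rcases isReal_or_isComplex w with h | h
        · rw [mixedEmbedding.normAtPlace_apply_of_isReal h, if_pos h]
          exact h₁ ⟨w, h⟩
        · rw [mixedEmbedding.normAtPlace_apply_of_isComplex h,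
            if_neg (not_isReal_iff_isComplex.2 h)]
          exact Real.le_sqrt_of_sq_le (h₂ ⟨w, h⟩)
      · refine fun H => ⟨fun w => ?_, fun w => ?_⟩
        · have := H w
          rw [mixedEmbedding.normAtPlace_apply_of_isReal w.2, if_pos w.2] at this
          exact this
        · have := H w
          rw [mixedEmbedding.normAtPlace_apply_of_isComplex w.2,
            if_neg (not_isReal_iff_isComplex.2 w.2)] at this
          exact (Real.le_sqrt (norm_nonneg _) (ψ w _).2).1 this
  · refine ZeroOneLaw.volume_approxSet (r := fun w n => ψ w n)
      (fun w n => (ψ w n).2) (fun ε hε => ?_) fun x γ => ?_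
    · lift ε to ℝ≥0 using hε.le
      exact_mod_cast ZeroOneLaw.exists_lt_of_tendsto_bigPsi hψ (by exact_mod_cast hε)
    · constructor
      · rintro ⟨h₁, h₂⟩ w
        rcases isReal_or_isComplex w with h | h
        · rw [mixedEmbedding.normAtPlace_apply_of_isReal h]
          exact h₁ ⟨w, h⟩
        · rw [mixedEmbedding.normAtPlace_apply_of_isComplex h]
          exact h₂ ⟨w, h⟩
      · refine fun H => ⟨fun w => ?_, fun w => ?_⟩
        · have := H w
          rwa [mixedEmbedding.normAtPlace_apply_of_isReal w.2] at this
        · have := H w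
          rwa [mixedEmbedding.normAtPlace_apply_of_isComplex w.2] at this
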